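/- Let $\mathbb{D}$ and $\mathbb{T}$ be the open unit disk and the unit circle, and let $m$ be normalized Lebesgue measure on $\mathbb{T}$. Let $H^1$ be the space of holomorphic functions $f$ on $\mathbb{D}$ with $\sup_{0<r<1}\int_{\mathbb{T}}|f(r\zeta)|\,dm(\zeta)<\infty$; for $f\in H^1$ write $f^*(\zeta)=\lim_{r\to1^-}f(r\zeta)$ for the radial limit at $\zeta\in\mathbb{T}$. A non-zero function $f\in H^1$ is called rigid if the only functions $g\in H^1$ satisfying $\arg g^*=\arg f^*$ $m$-almost everywhere on $\mathbb{T}$ (that is, at $m$-almost every point both radial limits exist, are non-zero, and have the same argument) are $g=\lambda f$ with a constant $\lambda>0$. For each integer $k\ge 2$ define $$h_k(z)=\frac{1}{1-z}\log\left(\frac{1+z+\dots+z^{k-1}}{k}\right),\qquad z\in\mathbb{D},$$ where $\log$ is the principal branch of the logarithm (its argument never lies in $(-\infty,0]$ for $z\in\mathbb{D}$). **Theorem.** For every integer $k\ge 2$, the function $h_k$ belongs to $H^1$ and is rigid. -/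

import Mathlib

open Set Filter Topology MeasureTheory

noncomputable section

/-- The function `h_k(z) = (1 / (1 - z)) log ((1 + z + ⋯ + z^(k-1)) / k)`. On the open unit disk
`1 + z + ⋯ + z^(k-1) = (1 - z^k) / (1 - z)` is a quotient of two numbers with positive real part
(for `k ≥ 1`), hence never in `(-∞, 0]`, so that the principal branch is a holomorphic one. -/
def nymanH (k : ℕ) (z : ℂ) : ℂ :=
  1 / (1 - z) * Complex.log ((∑ j ∈ Finset.range k, z ^ j) / (k : ℂ))

/-- `f` restricts to a member of the Hardy space `H¹` of the open unit disk: it is holomorphic there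
and its means `(1 / 2π) ∫ |f (r e^{iθ})| dθ`, `0 < r < 1`, are bounded.
(Values of `f` outside the disk play no role.) -/
def MemHardyOne (f : ℂ → ℂ) : Prop :=
  DifferentiableOn ℂ f (Metric.ball 0 1) ∧
    ∃ C : ℝ, ∀ r ∈ Ioo (0 : ℝ) 1,
      (2 * Real.pi)⁻¹ * ∫ θ in (0 : ℝ)..2 * Real.pi, ‖f (circleMap 0 r θ)‖ ≤ C

/-- The radial limit of `f` at the point `e^{iθ}` of the unit circle exists and equals `a`. -/
def HasRadialLimit (f : ℂ → ℂ) (θ : ℝ) (a : ℂ) : Prop :=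
  Tendsto (fun r : ℝ => f (circleMap 0 r θ)) (𝓝[<] 1) (𝓝 a)

/-- `arg g = arg f` almost everywhere on the unit circle: at almost every point the radial limits
of `f` and `g` exist, are non-zero (so that they have an argument), and have the same argument. -/
def SameBoundaryArg (f g : ℂ → ℂ) : Prop :=
  ∀ᵐ θ : ℝ ∂volume.restrict (Ioc 0 (2 * Real.pi)),
    ∃ a b : ℂ, HasRadialLimit f θ a ∧ HasRadialLimit g θ b ∧ a ≠ 0 ∧ b ≠ 0 ∧ b.arg = a.arg

/-- `f` is a rigid function: a non-zero member of `H¹` such that the only members `g` of `H¹` with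
`arg g = arg f` almost everywhere on the unit circle are `g = c f` with `c > 0`. -/
def IsRigid (f : ℂ → ℂ) : Prop :=
  MemHardyOne f ∧ (∃ z ∈ Metric.ball (0 : ℂ) 1, f z ≠ 0) ∧
    ∀ g : ℂ → ℂ, MemHardyOne g → SameBoundaryArg f g →
      ∃ c : ℝ, 0 < c ∧ ∀ z ∈ Metric.ball (0 : ℂ) 1, g z = (c : ℂ) * f z

end

/-!
The function `h_k` is rigid because it is bounded away from zero on the unit disk.

Write `G z = (1 + z + ⋯ + z^(k-1)) / k`, so that `h_k z = log (G z) / (1 - z)`. On the closed disk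
`|G| < 1` except at `z = 1`, hence `|log G| ≥ -log |G|` is bounded below away from `1`; at `z = 1`,
`log G` has a simple zero, so that `h_k` has a non-zero limit there (`exists_le_norm_nymanH`). That
`h_k` is in `H¹` follows from `|log G| ≤ -log |G| + π` and the mean value property of the harmonic
function `log |G|` (`memHardyOne_nymanH`).

If `f ∈ H¹` is bounded away from zero and `g ∈ H¹` has the same boundary argument, then `F = g / f`
is in `H¹` and its radial limits are positive almost everywhere. So it suffices that an `F ∈ H¹`
with real boundary values is constant (`MemHardyOne.exists_eq_const`). Membership in `H¹` cannot be
relaxed to all `H^p` with `p < 1` here, as `i (1 + z) / (1 - z)` shows: the point is that the dilates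
`F (r ·)` are uniformly integrable on the circle, which allows one to pass to the limit `r → 1` in
the Poisson integral formula for `Im F`.

Uniform integrability is obtained as follows. By the Poisson integral formula for `log |F|`, after
splitting off the zeros, `log |F|` and hence `√|F|` are subharmonic
(`log_norm_le_circleAverage`, `sqrt_norm_le_circleAverage`). The dilates of `√|F|` are bounded in
`L²`, so that a truncation argument (`le_integral_mul_of_tendsto`) bounds `√|F|` by the Poisson
integral of its boundary values. By the inequality of arithmetic and geometric means the same is
true of `|F|` (`MemHardyOne.norm_le_integral`); and the tails `(|F (r ·)| - M)⁺` have means at most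
that of the tail of the integrable boundary function (`MemHardyOne.integral_tail_le`).
-/

/-! ### Subharmonicity of `log ‖F‖` and `√‖F‖` -/

/-- In particular `|w - u| ≤ |1 - ū w|` for `u`, `w` in the closed unit disk, with equality if one
of them lies on the unit circle. -/
lemma norm_sub_sq_add (u w : ℂ) :
    ‖1 - (starRingEnd ℂ) u * w‖ ^ 2 = ‖w - u‖ ^ 2 + (1 - ‖u‖ ^ 2) * (1 - ‖w‖ ^ 2) := by
  simp only [← Complex.normSq_eq_norm_sq, Complex.normSq_apply]
  simp
  ring

lemma poissonKernel_nonneg {w z : ℂ} (hw : w ∈ Metric.ball (0 : ℂ) 1)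
    (hz : z ∈ Metric.sphere (0 : ℂ) 1) : 0 ≤ poissonKernel 0 w z := by
  simp only [mem_sphere_iff_norm, sub_zero, mem_ball_iff_norm] at hz hw
  rw [poissonKernel_def]
  have : ‖w‖ ^ 2 ≤ 1 := pow_le_one₀ (norm_nonneg _) hw.le
  simp only [sub_zero, hz]
  apply div_nonneg <;> nlinarith [sq_nonneg ‖z - w‖]

lemma continuousOn_poissonKernel {w : ℂ} (hw : w ∈ Metric.ball (0 : ℂ) 1) :
    ContinuousOn (poissonKernel 0 w) (Metric.sphere 0 |1|) := by
  rw [poissonKernel_eq_re_herglotzRieszKernel]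
  exact Complex.continuous_re.comp_continuousOn (continuousOn_herglotzRieszKernel_sphere hw)

lemma circleIntegrable_poissonKernel_mul {w : ℂ} (hw : w ∈ Metric.ball (0 : ℂ) 1) {f : ℂ → ℝ}
    (hf : CircleIntegrable f 0 1) : CircleIntegrable (poissonKernel 0 w * f) 0 1 :=
  hf.continuousOn_smul (continuousOn_poissonKernel hw)

lemma circleAverage_poissonKernel {w : ℂ} (hw : w ∈ Metric.ball (0 : ℂ) 1) :
    Real.circleAverage (poissonKernel 0 w) 0 1 = 1 := by
  have h := InnerProductSpace.HarmonicOnNhd.circleAverage_poissonKernel_smul (f := fun _ ↦ (1 : ℝ))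
    (c := 0) (w := w) (R := 1) ?_ hw
  · convert h using 2
    ext z
    simp
  · intro z _
    exact InnerProductSpace.harmonicAt_const _

/-- The logarithmic kernel `z ↦ log |z - u|` is subharmonic. For `u` inside the disk it is compared
with `log |1 - ū z|`, which is harmonic on the closed disk and has the same values on the circle. -/
lemma log_norm_sub_le_circleAverage {u w : ℂ} (hu : u ∈ Metric.closedBall (0 : ℂ) 1)
    (hw : w ∈ Metric.ball (0 : ℂ) 1) (hwu : w ≠ u) :
    Real.log ‖w - u‖ ≤
      Real.circleAverage (poissonKernel 0 w * fun z ↦ Real.log ‖z - u‖) 0 1 := by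
  have hu' : ‖u‖ ≤ 1 := by simpa using hu
  have hw' : ‖w‖ < 1 := by simpa using hw
  rcases hu'.eq_or_lt with h | h
  · rw [poissonKernel_eq_re_herglotzRieszKernel,
      circleAverage_re_herglotzRieszKernel_mul_log (by simpa using h) hw]
  · have hharm : InnerProductSpace.HarmonicOnNhd
        (fun z ↦ Real.log ‖1 - (starRingEnd ℂ) u * z‖) (Metric.closedBall 0 1) := by
      intro z hz
      have hz' : ‖z‖ ≤ 1 := by simpa using hz
      refine AnalyticAt.harmonicAt_log_norm (f := fun z ↦ 1 - (starRingEnd ℂ) u * z)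
        (by fun_prop) fun h0 ↦ ?_
      have : ‖(starRingEnd ℂ) u * z‖ = 1 := by rw [← sub_eq_zero.1 h0]; simp
      rw [norm_mul, Complex.norm_conj] at this
      nlinarith [norm_nonneg u, norm_nonneg z]
    have key := hharm.circleAverage_poissonKernel_smul hw
    have hcongr : Real.circleAverage (poissonKernel 0 w * fun z ↦ Real.log ‖z - u‖) 0 1 =
        Real.circleAverage
          (poissonKernel 0 w • fun z ↦ Real.log ‖1 - (starRingEnd ℂ) u * z‖) 0 1 := by
      refine Real.circleAverage_congr_sphere fun z hz ↦ ?_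
      have hz' : ‖z‖ = 1 := by simpa using hz
      have h1 := norm_sub_sq_add u z
      rw [hz'] at h1
      have h2 : ‖1 - (starRingEnd ℂ) u * z‖ = ‖z - u‖ := by
        rw [← sq_eq_sq₀ (norm_nonneg _) (norm_nonneg _), h1]; ring
      simp [h2]
    rw [hcongr, key]
    refine Real.log_le_log (norm_pos_iff.2 (sub_ne_zero.2 hwu)) ?_
    rw [← sq_le_sq₀ (norm_nonneg _) (norm_nonneg _), norm_sub_sq_add]
    have : 0 ≤ (1 - ‖u‖ ^ 2) * (1 - ‖w‖ ^ 2) :=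
      mul_nonneg (by nlinarith [norm_nonneg u]) (by nlinarith [norm_nonneg w])
    linarith

lemma circleIntegrable_log_norm {F : ℂ → ℂ} (hF : AnalyticOnNhd ℂ F (Metric.closedBall 0 1)) :
    CircleIntegrable (fun z ↦ Real.log ‖F z‖) 0 1 :=
  MeromorphicOn.circleIntegrable_log_norm (hF.meromorphicOn.mono_set
    (by simpa using Metric.sphere_subset_closedBall))

/-- Subharmonicity of `log |F|`: split off the zeros of `F` in the closed disk. -/
theorem log_norm_le_circleAverage {F : ℂ → ℂ} (hF : AnalyticOnNhd ℂ F (Metric.closedBall 0 1))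
    {w : ℂ} (hw : w ∈ Metric.ball (0 : ℂ) 1) (hFw : F w ≠ 0) :
    Real.log ‖F w‖ ≤
      Real.circleAverage (poissonKernel 0 w * fun z ↦ Real.log ‖F z‖) 0 1 := by
  set U : Set ℂ := Metric.closedBall 0 1 with hU
  have hwU : w ∈ U := Metric.ball_subset_closedBall hw
  have hconn : IsConnected U :=
    ⟨⟨w, hwU⟩, (convex_closedBall (0 : ℂ) 1).isPreconnected⟩
  have hord : ∀ u : U, meromorphicOrderAt F u ≠ ⊤ := by
    rw [← hF.meromorphicOn.exists_meromorphicOrderAt_ne_top_iff_forall hconn]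
    refine ⟨⟨w, hwU⟩, ?_⟩
    rw [((hF w hwU).meromorphicNFAt.meromorphicOrderAt_eq_zero_iff).2 hFw]
    simp
  set D := MeromorphicOn.divisor F U with hD
  have hfin : D.support.Finite := D.finiteSupport (isCompact_closedBall 0 1)
  have hDw : D w = 0 := by
    rw [hD, MeromorphicOn.divisor_apply hF.meromorphicOn hwU,
      ((hF w hwU).meromorphicNFAt.meromorphicOrderAt_eq_zero_iff).2 hFw]
    rfl
  have hD0 : ∀ u, 0 ≤ D u := fun u ↦ MeromorphicOn.AnalyticOnNhd.divisor_nonneg hF u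
  obtain ⟨g, hg, hg0, hFg⟩ := hF.meromorphicOn.extract_zeros_poles hord hfin
  have hacc : AccPt w (𝓟 U) := by
    refine accPt_iff_frequently_nhdsNE.2 (Eventually.frequently ?_)
    exact eventually_nhdsWithin_of_eventually_nhds
      (mem_of_superset (Metric.isOpen_ball.mem_nhds hw) Metric.ball_subset_closedBall)
  have hsum : ∀ φ : ℂ → ℝ, ∑ᶠ u, (D u : ℝ) * φ u = ∑ u ∈ hfin.toFinset, (D u : ℝ) * φ u := by
    intro φ
    refine finsum_eq_sum_of_support_subset _ fun u hu ↦ ?_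
    simp only [Finite.coe_toFinset, Function.mem_support] at hu ⊢
    intro h0
    exact hu (by simp [h0])
  -- the value at `w`
  have h1 : Real.log ‖F w‖ = ∑ u ∈ hfin.toFinset, (D u : ℝ) * Real.log ‖w - u‖ +
      Real.log ‖g w‖ := by
    rw [← hsum, ← MeromorphicOn.log_norm_meromorphicTrailingCoeffAt_extract_zeros_poles hfin hwU
      hacc (hF w hwU).meromorphicAt (hg w hwU) (hg0 ⟨w, hwU⟩) hFg,
      (hF w hwU).meromorphicTrailingCoeffAt_of_ne_zero hFw]
  -- the values on the circle
  have h2 : (fun z ↦ Real.log ‖F z‖) =ᶠ[codiscreteWithin (Metric.sphere 0 |1|)]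
      fun z ↦ ∑ u ∈ hfin.toFinset, (D u : ℝ) * Real.log ‖z - u‖ + Real.log ‖g z‖ := by
    have := MeromorphicOn.extract_zeros_poles_log hg0 hFg
    refine (this.filter_mono (codiscreteWithin_mono
      (by simpa using Metric.sphere_subset_closedBall))).trans (Eventually.of_forall fun z ↦ ?_)
    have hfs : (fun u ↦ fun x : ℂ ↦ (D u : ℝ) * Real.log ‖x - u‖).support ⊆ hfin.toFinset := by
      intro u hu
      simp only [Finite.coe_toFinset, Function.mem_support] at hu ⊢
      intro h0
      exact hu (by ext; simp [h0])
    simp only [Pi.add_apply]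
    rw [finsum_eq_sum_of_support_subset (s := hfin.toFinset) _ hfs, Finset.sum_apply]
  have hint : ∀ u : ℂ, CircleIntegrable (fun z ↦ Real.log ‖z - u‖) 0 1 := fun u ↦
    circleIntegrable_log_norm (F := fun z ↦ z - u) (by intro z _; fun_prop)
  have hgint : CircleIntegrable (fun z ↦ Real.log ‖g z‖) 0 1 := circleIntegrable_log_norm hg
  have h3 : Real.circleAverage (poissonKernel 0 w * fun z ↦ Real.log ‖F z‖) 0 1 =
      ∑ u ∈ hfin.toFinset,
        (D u : ℝ) * Real.circleAverage (poissonKernel 0 w * fun z ↦ Real.log ‖z - u‖) 0 1 +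
      Real.circleAverage (poissonKernel 0 w * fun z ↦ Real.log ‖g z‖) 0 1 := by
    have h4 : (poissonKernel 0 w * fun z ↦ Real.log ‖F z‖)
        =ᶠ[codiscreteWithin (Metric.sphere 0 |1|)]
        (∑ u ∈ hfin.toFinset, (D u : ℝ) • (poissonKernel 0 w * fun z ↦ Real.log ‖z - u‖)) +
          (poissonKernel 0 w * fun z ↦ Real.log ‖g z‖) := by
      filter_upwards [h2] with z hz
      simp only [Pi.mul_apply, Pi.add_apply, Finset.sum_apply, Pi.smul_apply, smul_eq_mul, hz,
        mul_add, Finset.mul_sum]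
      congr 1
      exact Finset.sum_congr rfl fun u _ ↦ by ring
    have hi : ∀ u ∈ hfin.toFinset, CircleIntegrable
        ((D u : ℝ) • (poissonKernel 0 w * fun z ↦ Real.log ‖z - u‖)) 0 1 := fun u _ ↦
      IntervalIntegrable.const_mul (circleIntegrable_poissonKernel_mul hw (hint u)) _
    rw [Real.circleAverage_congr_codiscreteWithin h4 one_ne_zero,
      Real.circleAverage_add (CircleIntegrable.sum _ hi)
        (circleIntegrable_poissonKernel_mul hw hgint), Real.circleAverage_sum hi]
    simp only [Real.circleAverage_smul, smul_eq_mul]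
  have h5 : Real.circleAverage (poissonKernel 0 w * fun z ↦ Real.log ‖g z‖) 0 1 =
      Real.log ‖g w‖ :=
    InnerProductSpace.HarmonicOnNhd.circleAverage_poissonKernel_smul
      (fun z hz ↦ (hg z hz).harmonicAt_log_norm (hg0 ⟨z, hz⟩)) hw
  rw [h1, h3, h5]
  gcongr with u hu
  · exact_mod_cast hD0 u
  · have huD : D u ≠ 0 := by simpa using hu
    exact log_norm_sub_le_circleAverage (D.supportWithinDomain huD) hw
      fun h ↦ huD (h ▸ hDw)

/-- Subharmonicity of `√|F|`: Jensen's inequality for the exponential function, in the form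
`e^(x/2) ≥ e^(m/2) (1 + (x - m) / 2)` with `m = log |F w|`, turns the estimate of `log |F|` into
one of `√|F|`. -/
theorem sqrt_norm_le_circleAverage {F : ℂ → ℂ} (hF : AnalyticOnNhd ℂ F (Metric.closedBall 0 1))
    {w : ℂ} (hw : w ∈ Metric.ball (0 : ℂ) 1) :
    √‖F w‖ ≤ Real.circleAverage (poissonKernel 0 w * fun z ↦ √‖F z‖) 0 1 := by
  by_cases hFw : F w = 0
  · rw [hFw, norm_zero, Real.sqrt_zero]
    refine Real.circleAverage_nonneg_of_nonneg fun z hz ↦ ?_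
    exact mul_nonneg (poissonKernel_nonneg hw (by simpa using hz)) (Real.sqrt_nonneg _)
  have hwU := Metric.ball_subset_closedBall hw
  have hexp : ∀ x : ℝ, 0 < x → √x = Real.exp (Real.log x / 2) := fun x hx ↦ by
    rw [Real.sqrt_eq_rpow, Real.rpow_def_of_pos hx]; ring_nf
  set m := Real.log ‖F w‖ with hm
  set s := √‖F w‖ with hs
  have hs' : s = Real.exp (m / 2) := hexp _ (norm_pos_iff.2 hFw)
  set f₁ : ℂ → ℝ := (s * (1 - m / 2)) • poissonKernel 0 w +
    (s / 2) • (poissonKernel 0 w * fun z ↦ Real.log ‖F z‖) with hf₁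
  have hK : CircleIntegrable (poissonKernel 0 w) 0 1 :=
    ContinuousOn.circleIntegrable' (continuousOn_poissonKernel hw)
  have hKF := circleIntegrable_poissonKernel_mul hw (circleIntegrable_log_norm hF)
  have hi1 : CircleIntegrable ((s * (1 - m / 2)) • poissonKernel 0 w) 0 1 :=
    IntervalIntegrable.const_mul hK _
  have hi2 : CircleIntegrable
      ((s / 2) • (poissonKernel 0 w * fun z ↦ Real.log ‖F z‖)) 0 1 :=
    IntervalIntegrable.const_mul hKF _
  have hlow : s ≤ Real.circleAverage f₁ 0 1 := by
    rw [hf₁, Real.circleAverage_add hi1 hi2, Real.circleAverage_smul, Real.circleAverage_smul,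
      circleAverage_poissonKernel hw, smul_eq_mul, smul_eq_mul]
    have := log_norm_le_circleAverage hF hw hFw
    have hs0 : 0 ≤ s / 2 := by positivity
    nlinarith [mul_le_mul_of_nonneg_left this hs0]
  -- at a zero of `F` the value `log 0 = 0` would spoil the comparison, so it is changed to `0`
  set f₂ : ℂ → ℝ := fun z ↦ if F z = 0 then 0 else f₁ z with hf₂
  have hcod : f₂ =ᶠ[codiscreteWithin (Metric.sphere 0 |1|)] f₁ := by
    have := hF.preimage_zero_mem_codiscreteWithin hFw hwU
      ⟨⟨w, hwU⟩, (convex_closedBall (0 : ℂ) 1).isPreconnected⟩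
    have hsub : Metric.sphere (0 : ℂ) |1| ⊆ Metric.closedBall 0 1 := by
      simpa using Metric.sphere_subset_closedBall
    filter_upwards [codiscreteWithin_mono hsub this] with z hz
    have : F z ≠ 0 := by simpa using hz
    simp [hf₂, this]
  have hi3 : CircleIntegrable f₂ 0 1 :=
    CircleIntegrable.congr_codiscreteWithin hcod.symm (hi1.add hi2)
  have hi4 : CircleIntegrable (poissonKernel 0 w * fun z ↦ √‖F z‖) 0 1 := by
    refine circleIntegrable_poissonKernel_mul hw (ContinuousOn.circleIntegrable' ?_)
    refine (continuous_norm.sqrt).comp_continuousOn (hF.continuousOn.mono ?_)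
    simpa using Metric.sphere_subset_closedBall
  refine hlow.trans ?_
  rw [← Real.circleAverage_congr_codiscreteWithin hcod one_ne_zero]
  refine Real.circleAverage_mono hi3 hi4 fun z hz ↦ ?_
  have hKz := poissonKernel_nonneg hw (z := z) (by simpa using hz)
  by_cases h0 : F z = 0
  · simp [hf₂, h0]
  · have h1 := Real.add_one_le_exp ((Real.log ‖F z‖ - m) / 2)
    have h2 : √‖F z‖ = s * Real.exp ((Real.log ‖F z‖ - m) / 2) := by
      rw [hexp _ (norm_pos_iff.2 h0), hs', ← Real.exp_add]
      ring_nf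
    simp only [hf₂, h0, if_false, hf₁, Pi.add_apply, Pi.smul_apply, Pi.mul_apply, smul_eq_mul]
    rw [h2]
    have hs0 : 0 ≤ s := Real.sqrt_nonneg _
    have := mul_le_mul_of_nonneg_left h1 (mul_nonneg hKz hs0)
    nlinarith

/-! ### A limit theorem for uniformly integrable sequences -/

/-- Passage to the limit in `s n ≤ ∫ k u_n` when `u_n → v` almost everywhere and the `u_n` are
uniformly integrable: truncate `u_n` at a height `M`, apply bounded convergence to `min u_n M`,
and estimate the rest by the tail `∫ (u_n - M)⁺`. -/
theorem le_integral_mul_of_tendsto {α : Type*} [MeasurableSpace α] {μ : Measure α}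
    [IsFiniteMeasure μ] {k v : α → ℝ} {u : ℕ → α → ℝ} {A t : ℝ} {s : ℕ → ℝ}
    (hk0 : ∀ x, 0 ≤ k x) (hkA : ∀ x, k x ≤ A) (hA : 0 ≤ A) (hkm : Measurable k)
    (hu0 : ∀ n x, 0 ≤ u n x) (hui : ∀ n, Integrable (u n) μ) (hv : Integrable v μ)
    (hlim : ∀ᵐ x ∂μ, Tendsto (fun n ↦ u n x) atTop (𝓝 (v x)))
    (htail : ∀ ε > 0, ∃ M : ℝ, ∀ n, ∫ x, max (u n x - M) 0 ∂μ ≤ ε)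
    (hs : Tendsto s atTop (𝓝 t)) (hle : ∀ n, s n ≤ ∫ x, k x * u n x ∂μ) :
    t ≤ ∫ x, k x * v x ∂μ := by
  have hbdd : ∀ {f : α → ℝ}, Integrable f μ → Integrable (fun x ↦ k x * f x) μ := fun hf ↦
    hf.bdd_mul (c := A) hkm.aestronglyMeasurable
      (Eventually.of_forall fun x ↦ by rw [Real.norm_of_nonneg (hk0 x)]; exact hkA x)
  refine le_of_forall_pos_le_add fun ε hε ↦ ?_
  obtain ⟨M, hM⟩ := htail (ε / (A + 1)) (by positivity)
  have hmin : ∀ {f : α → ℝ}, Integrable f μ → Integrable (fun x ↦ min (f x) M) μ :=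
    fun hf ↦ hf.inf (integrable_const M)
  have hmax : ∀ n, Integrable (fun x ↦ max (u n x - M) 0) μ := fun n ↦
    ((hui n).sub (integrable_const M)).sup (integrable_const 0)
  have h1 : ∀ n, s n ≤ ∫ x, k x * min (u n x) M ∂μ + ε := by
    intro n
    calc s n ≤ ∫ x, k x * u n x ∂μ := hle n
      _ ≤ ∫ x, (k x * min (u n x) M + A * max (u n x - M) 0) ∂μ := by
        refine integral_mono (hbdd (hui n))
          ((hbdd (hmin (hui n))).add ((hmax n).const_mul A)) fun x ↦ ?_
        have h : u n x = min (u n x) M + max (u n x - M) 0 := by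
          rcases le_total (u n x) M with h | h
          · rw [min_eq_left h, max_eq_right (by linarith)]; ring
          · rw [min_eq_right h, max_eq_left (by linarith)]; ring
        have h' : (0 : ℝ) ≤ max (u n x - M) 0 := le_max_right _ _
        calc k x * u n x = k x * min (u n x) M + k x * max (u n x - M) 0 := by
              rw [← mul_add, ← h]
          _ ≤ _ := by gcongr; exact hkA x
      _ = ∫ x, k x * min (u n x) M ∂μ + A * ∫ x, max (u n x - M) 0 ∂μ := by
        rw [integral_add (hbdd (hmin (hui n))) ((hmax n).const_mul A), integral_const_mul]
      _ ≤ ∫ x, k x * min (u n x) M ∂μ + ε := by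
        gcongr
        calc A * ∫ x, max (u n x - M) 0 ∂μ ≤ A * (ε / (A + 1)) := by gcongr; exact hM n
          _ ≤ ε := by
            rw [mul_div_assoc', div_le_iff₀ (by positivity)]
            nlinarith
  have h2 : Tendsto (fun n ↦ ∫ x, k x * min (u n x) M ∂μ) atTop
      (𝓝 (∫ x, k x * min (v x) M ∂μ)) := by
    refine tendsto_integral_of_dominated_convergence (fun _ ↦ A * |M|)
      (fun n ↦ (hbdd (hmin (hui n))).aestronglyMeasurable) (integrable_const _)
      (fun n ↦ Eventually.of_forall fun x ↦ ?_) ?_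
    · rw [norm_mul, Real.norm_of_nonneg (hk0 x), Real.norm_eq_abs]
      have : |min (u n x) M| ≤ |M| := by
        have := hu0 n x
        rcases le_total (u n x) M with h | h
        · rw [min_eq_left h, abs_of_nonneg this]
          exact h.trans (le_abs_self M)
        · rw [min_eq_right h]
      gcongr
      exact hkA x
    · filter_upwards [hlim] with x hx
      exact (hx.min tendsto_const_nhds).const_mul _
  have h3 : t ≤ ∫ x, k x * min (v x) M ∂μ + ε :=
    le_of_tendsto_of_tendsto' hs (h2.add_const ε) h1
  refine h3.trans (add_le_add (integral_mono (hbdd (hmin hv)) (hbdd hv) fun x ↦ ?_) le_rfl)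
  exact mul_le_mul_of_nonneg_left (min_le_left _ _) (hk0 x)

/-! ### Normalized arc length and the Poisson kernel -/

/-- Normalized arc length of the unit circle, in the angular coordinate `θ ∈ (0, 2π]`. -/
noncomputable def arcMeasure : Measure ℝ :=
  ENNReal.ofReal (2 * Real.pi)⁻¹ • volume.restrict (Ioc 0 (2 * Real.pi))

instance : IsFiniteMeasure arcMeasure := by
  unfold arcMeasure
  exact Measure.smul_finite _ ENNReal.ofReal_ne_top

lemma circleAverage_eq_integral_arcMeasure (f : ℂ → ℝ) (R : ℝ) :
    Real.circleAverage f 0 R = ∫ θ, f (circleMap 0 R θ) ∂arcMeasure := by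
  rw [Real.circleAverage_def, intervalIntegral.integral_of_le Real.two_pi_pos.le, arcMeasure,
    integral_smul_measure, ENNReal.toReal_ofReal (by positivity)]

lemma ae_arcMeasure_iff {p : ℝ → Prop} :
    (∀ᵐ θ ∂arcMeasure, p θ) ↔ ∀ᵐ θ ∂volume.restrict (Ioc 0 (2 * Real.pi)), p θ := by
  rw [arcMeasure, Measure.ae_ennreal_smul_measure_iff]
  simp [Real.pi_pos]

lemma integrable_arcMeasure_of_continuous {f : ℝ → ℝ} (hf : Continuous f) :
    Integrable f arcMeasure :=
  Integrable.smul_measure hf.integrableOn_Ioc ENNReal.ofReal_ne_top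

/-- The Poisson kernel of the unit disk at the boundary point `e^{it}`. -/
noncomputable def arcPoisson (w : ℂ) (t : ℝ) : ℝ := poissonKernel 0 w (circleMap 0 1 t)

lemma arcPoisson_eq (w : ℂ) (t : ℝ) :
    arcPoisson w t = (1 - ‖w‖ ^ 2) / ‖circleMap 0 1 t - w‖ ^ 2 := by
  simp [arcPoisson, poissonKernel_def]

lemma arcPoisson_nonneg {w : ℂ} (hw : w ∈ Metric.ball (0 : ℂ) 1) (t : ℝ) : 0 ≤ arcPoisson w t :=
  poissonKernel_nonneg hw (by simp)

lemma measurable_arcPoisson (w : ℂ) : Measurable (arcPoisson w) := by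
  simp only [funext (arcPoisson_eq w)]
  exact measurable_const.div ((by fun_prop : Continuous fun t ↦
    ‖circleMap 0 1 t - w‖ ^ 2).measurable)

lemma arcPoisson_le {w : ℂ} (hw : w ∈ Metric.ball (0 : ℂ) 1) (t : ℝ) :
    arcPoisson w t ≤ (1 + ‖w‖) / (1 - ‖w‖) := by
  rw [arcPoisson, poissonKernel_eq_re_herglotzRieszKernel]
  simpa [herglotzRieszKernel_def] using
    re_herglotzRieszKernel_le (c := 0) (z := circleMap 0 1 t) (by simp) hw

lemma integral_arcPoisson {w : ℂ} (hw : w ∈ Metric.ball (0 : ℂ) 1) :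
    ∫ t, arcPoisson w t ∂arcMeasure = 1 := by
  rw [← circleAverage_poissonKernel hw, circleAverage_eq_integral_arcMeasure]
  rfl

lemma integrable_arcPoisson_mul {w : ℂ} (hw : w ∈ Metric.ball (0 : ℂ) 1) {f : ℝ → ℝ}
    (hf : Integrable f arcMeasure) : Integrable (fun t ↦ arcPoisson w t * f t) arcMeasure :=
  hf.bdd_mul (c := (1 + ‖w‖) / (1 - ‖w‖)) (measurable_arcPoisson w).aestronglyMeasurable
    (Eventually.of_forall fun x ↦ by
      rw [Real.norm_of_nonneg (arcPoisson_nonneg hw x)]; exact arcPoisson_le hw x)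

lemma integrable_arcPoisson {w : ℂ} (hw : w ∈ Metric.ball (0 : ℂ) 1) :
    Integrable (arcPoisson w) arcMeasure := by
  simpa using integrable_arcPoisson_mul hw (integrable_const 1)

/-- The Poisson kernel at `r e^{iθ}` and `e^{it}` depends on the difference `θ - t` only, so that
the two angles may be exchanged. -/
lemma arcPoisson_circleMap_comm (r θ t : ℝ) :
    arcPoisson (circleMap 0 r θ) t = arcPoisson (circleMap 0 r t) θ := by
  rw [arcPoisson_eq, arcPoisson_eq, norm_circleMap_zero, norm_circleMap_zero]
  congr 1
  simp only [← Complex.normSq_eq_norm_sq, Complex.normSq_apply, Complex.sub_re, Complex.sub_im,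
    circleMap_zero_re, circleMap_zero_im]
  linear_combination (1 - r ^ 2) * (Real.sin_sq_add_cos_sq t) -
    (1 - r ^ 2) * (Real.sin_sq_add_cos_sq θ)

lemma circleMap_mem_unitBall {r : ℝ} (hr : r ∈ Ioo (0 : ℝ) 1) (θ : ℝ) :
    circleMap 0 r θ ∈ Metric.ball (0 : ℂ) 1 := by
  simpa [abs_of_pos hr.1] using hr.2

lemma continuous_arcPoisson_uncurry {r : ℝ} (hr : r ∈ Ioo (0 : ℝ) 1) :
    Continuous fun p : ℝ × ℝ ↦ arcPoisson (circleMap 0 r p.1) p.2 := by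
  simp only [arcPoisson_eq]
  refine Continuous.div (by fun_prop) (by fun_prop) fun p h ↦ ?_
  have h1 : ‖circleMap 0 1 p.2‖ = ‖circleMap 0 r p.1‖ := by
    rw [sub_eq_zero.1 (norm_eq_zero.1 (pow_eq_zero_iff two_ne_zero |>.1 h))]
  rw [norm_circleMap_zero, norm_circleMap_zero, abs_one, abs_of_pos hr.1] at h1
  exact hr.2.ne h1.symm

lemma integrable_arcPoisson_prod {r : ℝ} (hr : r ∈ Ioo (0 : ℝ) 1) {h : ℝ → ℝ}
    (hh : Integrable h arcMeasure) :
    Integrable (Function.uncurry fun θ t ↦ arcPoisson (circleMap 0 r θ) t * h t)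
      (arcMeasure.prod arcMeasure) := by
  refine Integrable.bdd_mul (c := (1 + r) / (1 - r)) (hh.comp_snd arcMeasure)
    (continuous_arcPoisson_uncurry hr).aestronglyMeasurable (Eventually.of_forall fun p ↦ ?_)
  rw [Real.norm_of_nonneg (arcPoisson_nonneg (circleMap_mem_unitBall hr _) _)]
  simpa [abs_of_pos hr.1] using arcPoisson_le (circleMap_mem_unitBall hr p.1) p.2

/-- Taking Poisson integrals preserves the mean value over concentric circles. -/
lemma integral_integral_arcPoisson_mul {r : ℝ} (hr : r ∈ Ioo (0 : ℝ) 1) {h : ℝ → ℝ}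
    (hh : Integrable h arcMeasure) :
    ∫ θ, ∫ t, arcPoisson (circleMap 0 r θ) t * h t ∂arcMeasure ∂arcMeasure =
      ∫ t, h t ∂arcMeasure := by
  rw [integral_integral_swap (integrable_arcPoisson_prod hr hh)]
  refine integral_congr_ae (Eventually.of_forall fun t ↦ ?_)
  simp only [arcPoisson_circleMap_comm r _ t]
  rw [integral_mul_const, integral_arcPoisson (circleMap_mem_unitBall hr t), one_mul]

/-! ### Boundary values of functions in `H¹` -/

/-- A sequence of radii increasing to `1`. -/
noncomputable def radius (n : ℕ) : ℝ := 1 - 1 / ((n : ℝ) + 2)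

lemma radius_mem (n : ℕ) : radius n ∈ Ioo (0 : ℝ) 1 := by
  have h : (0 : ℝ) < (n : ℝ) + 2 := by positivity
  have h1 : 1 / ((n : ℝ) + 2) < 1 := by
    rw [div_lt_one h]
    linarith [(Nat.cast_nonneg n : (0 : ℝ) ≤ n)]
  exact ⟨by unfold radius; linarith, by unfold radius; linarith [one_div_pos.2 h]⟩

lemma tendsto_radius : Tendsto radius atTop (𝓝 1) := by
  have h : Tendsto (fun n : ℕ ↦ 1 / ((n : ℝ) + 2)) atTop (𝓝 0) :=
    tendsto_const_nhds.div_atTop (tendsto_atTop_add_const_right _ _ tendsto_natCast_atTop_atTop)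
  have h1 := h.const_sub 1
  rw [sub_zero] at h1
  exact h1

lemma tendsto_radius_left : Tendsto radius atTop (𝓝[<] 1) :=
  tendsto_nhdsWithin_iff.2 ⟨tendsto_radius, Eventually.of_forall fun n ↦ (radius_mem n).2⟩

lemma ofReal_mul_circleMap (r θ : ℝ) : (r : ℂ) * circleMap 0 1 θ = circleMap 0 r θ := by
  simp [circleMap]

/-- The dilate `z ↦ F (r z)` is analytic on the closed disk. -/
lemma DifferentiableOn.analyticOnNhd_dilate {F : ℂ → ℂ}
    (hF : DifferentiableOn ℂ F (Metric.ball 0 1)) {r : ℝ} (hr : r ∈ Ioo (0 : ℝ) 1) :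
    AnalyticOnNhd ℂ (fun z ↦ F (r * z)) (Metric.closedBall 0 1) := by
  have h := hF.analyticOnNhd Metric.isOpen_ball
  refine fun z hz ↦ (h _ ?_).fun_comp (f := fun z ↦ (r : ℂ) * z) (analyticAt_const.mul analyticAt_id)
  have hz' : ‖z‖ ≤ 1 := by simpa using hz
  simp only [mem_ball_zero_iff, norm_mul, Complex.norm_real, Real.norm_of_nonneg hr.1.le]
  nlinarith [hr.1, hr.2, norm_nonneg z]

lemma DifferentiableOn.continuous_circleMap {F : ℂ → ℂ}
    (hF : DifferentiableOn ℂ F (Metric.ball 0 1)) {r : ℝ} (hr : r ∈ Ioo (0 : ℝ) 1) :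
    Continuous fun θ ↦ F (circleMap 0 r θ) :=
  hF.continuousOn.comp_continuous (by fun_prop) (circleMap_mem_unitBall hr)

lemma DifferentiableOn.tendsto_dilate {F : ℂ → ℂ}
    (hF : DifferentiableOn ℂ F (Metric.ball 0 1)) {w : ℂ} (hw : w ∈ Metric.ball (0 : ℂ) 1) :
    Tendsto (fun n ↦ F (radius n * w)) atTop (𝓝 (F w)) := by
  have h1 : ContinuousAt F w := (hF.differentiableAt (Metric.isOpen_ball.mem_nhds hw)).continuousAt
  refine h1.tendsto.comp ?_
  have h2 : Tendsto (fun n ↦ (radius n : ℂ)) atTop (𝓝 ((1 : ℝ) : ℂ)) :=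
    (Complex.continuous_ofReal.tendsto 1).comp tendsto_radius
  simpa using h2.mul_const w

lemma MemHardyOne.exists_integral_le {F : ℂ → ℂ} (hF : MemHardyOne F) :
    ∃ C > 0, ∀ r ∈ Ioo (0 : ℝ) 1, ∫ θ, ‖F (circleMap 0 r θ)‖ ∂arcMeasure ≤ C := by
  obtain ⟨C, hC⟩ := hF.2
  refine ⟨max C 1, by positivity, fun r hr ↦ ?_⟩
  rw [← circleAverage_eq_integral_arcMeasure (fun z ↦ ‖F z‖), Real.circleAverage_def]
  exact (hC r hr).trans (le_max_left _ _)

section BoundaryValues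

variable {F : ℂ → ℂ} {f : ℝ → ℂ}

/-- By Fatou's lemma, the boundary values of a function in `H¹` are integrable. -/
theorem MemHardyOne.integrable_norm_boundary (hF : MemHardyOne F)
    (hf : ∀ᵐ θ ∂arcMeasure, HasRadialLimit F θ (f θ)) :
    Integrable (fun θ ↦ ‖f θ‖) arcMeasure := by
  obtain ⟨C, hC0, hC⟩ := hF.exists_integral_le
  refine integrable_of_tendsto (G := fun n θ ↦ ‖F (circleMap 0 (radius n) θ)‖) ?_
    (fun n ↦ (hF.1.continuous_circleMap (radius_mem n)).norm.aestronglyMeasurable) ?_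
  · filter_upwards [hf] with θ hθ
    exact (hθ.comp tendsto_radius_left).norm
  · refine ne_top_of_le_ne_top (ENNReal.ofReal_ne_top (r := C))
      (liminf_le_of_le (by isBoundedDefault) fun b hb ↦ ?_)
    obtain ⟨n, hn⟩ := hb.exists
    refine hn.trans ?_
    rw [← ofReal_integral_norm_eq_lintegral_enorm (integrable_arcMeasure_of_continuous
        (hF.1.continuous_circleMap (radius_mem n)).norm)]
    simp only [norm_norm]
    exact ENNReal.ofReal_le_ofReal (hC _ (radius_mem n))

/-- For `F` in `H¹`, the function `√|F|` is dominated by the Poisson integral of its boundary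
values: its dilates are bounded in `L²`, hence uniformly integrable. -/
theorem MemHardyOne.sqrt_norm_le_integral (hF : MemHardyOne F)
    (hf : ∀ᵐ θ ∂arcMeasure, HasRadialLimit F θ (f θ)) {w : ℂ} (hw : w ∈ Metric.ball (0 : ℂ) 1) :
    √‖F w‖ ≤ ∫ t, arcPoisson w t * √‖f t‖ ∂arcMeasure := by
  obtain ⟨C, hC0, hC⟩ := hF.exists_integral_le
  have hw' : ‖w‖ < 1 := by simpa using hw
  have hcont : ∀ n, Continuous fun θ ↦ F (circleMap 0 (radius n) θ) := fun n ↦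
    hF.1.continuous_circleMap (radius_mem n)
  have hlim : ∀ᵐ θ ∂arcMeasure,
      Tendsto (fun n ↦ √‖F (circleMap 0 (radius n) θ)‖) atTop (𝓝 √‖f θ‖) := by
    filter_upwards [hf] with θ hθ
    exact (hθ.comp tendsto_radius_left).norm.sqrt
  refine le_integral_mul_of_tendsto (A := (1 + ‖w‖) / (1 - ‖w‖))
    (u := fun n θ ↦ √‖F (circleMap 0 (radius n) θ)‖) (s := fun n ↦ √‖F (radius n * w)‖)
    (arcPoisson_nonneg hw) (arcPoisson_le hw) (div_nonneg (by positivity) (by linarith))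
    (measurable_arcPoisson w) (fun _ _ ↦ Real.sqrt_nonneg _)
    (fun n ↦ integrable_arcMeasure_of_continuous (hcont n).norm.sqrt) ?_ hlim ?_
    (hF.1.tendsto_dilate hw).norm.sqrt fun n ↦ ?_
  · refine ((hF.integrable_norm_boundary hf).add (integrable_const 1)).mono'
      (aestronglyMeasurable_of_tendsto_ae _
        (fun n ↦ (hcont n).norm.sqrt.aestronglyMeasurable) hlim) (Eventually.of_forall fun t ↦ ?_)
    rw [Real.norm_of_nonneg (Real.sqrt_nonneg _)]
    have := Real.sq_sqrt (norm_nonneg (f t))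
    simp only [Pi.add_apply]
    nlinarith [sq_nonneg (√‖f t‖ - 1), Real.sqrt_nonneg ‖f t‖]
  · -- the tail of `√|F|` is estimated by `(√|F| - M)⁺ ≤ |F| / M`
    intro ε hε
    refine ⟨C / ε, fun n ↦ ?_⟩
    have hM : 0 < C / ε := by positivity
    calc ∫ θ, max (√‖F (circleMap 0 (radius n) θ)‖ - C / ε) 0 ∂arcMeasure
        ≤ ∫ θ, (C / ε)⁻¹ * ‖F (circleMap 0 (radius n) θ)‖ ∂arcMeasure := by
          refine integral_mono
            (integrable_arcMeasure_of_continuous (((hcont n).norm.sqrt.sub continuous_const).max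
              continuous_const))
            ((integrable_arcMeasure_of_continuous (hcont n).norm).const_mul _) fun θ ↦ ?_
          set x := √‖F (circleMap 0 (radius n) θ)‖ with hx
          have hx2 : ‖F (circleMap 0 (radius n) θ)‖ = x ^ 2 := (Real.sq_sqrt (norm_nonneg _)).symm
          have hx0 : 0 ≤ x := Real.sqrt_nonneg _
          simp only [hx2]
          refine max_le ?_ (by positivity)
          rw [inv_mul_eq_div, le_div_iff₀ hM]
          nlinarith [sq_nonneg (x - C / ε)]
      _ ≤ (C / ε)⁻¹ * C := by
          rw [integral_const_mul]
          gcongr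
          exact hC _ (radius_mem n)
      _ = ε := by field_simp
  · have := sqrt_norm_le_circleAverage (hF.1.analyticOnNhd_dilate (radius_mem n)) hw
    rw [circleAverage_eq_integral_arcMeasure] at this
    simpa only [Pi.mul_apply, ofReal_mul_circleMap, arcPoisson] using this

/-- For `F` in `H¹`, the function `|F|` is dominated by the Poisson integral of its boundary
values: apply `2 s √|f| ≤ |f| + s²` with `s = √|F w|` to the estimate of `√|F|`. -/
theorem MemHardyOne.norm_le_integral (hF : MemHardyOne F)
    (hf : ∀ᵐ θ ∂arcMeasure, HasRadialLimit F θ (f θ)) {w : ℂ} (hw : w ∈ Metric.ball (0 : ℂ) 1) :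
    ‖F w‖ ≤ ∫ t, arcPoisson w t * ‖f t‖ ∂arcMeasure := by
  have h := hF.sqrt_norm_le_integral hf hw
  have hφ := hF.integrable_norm_boundary hf
  set s := √‖F w‖ with hs
  have hs0 : 0 ≤ s := Real.sqrt_nonneg _
  have hs2 : ‖F w‖ = s ^ 2 := (Real.sq_sqrt (norm_nonneg _)).symm
  have hi1 := integrable_arcPoisson_mul hw hφ
  have hi2 := (integrable_arcPoisson hw).mul_const (s ^ 2)
  have h1 : 2 * s * ∫ t, arcPoisson w t * √‖f t‖ ∂arcMeasure ≤
      ∫ t, arcPoisson w t * ‖f t‖ ∂arcMeasure + s ^ 2 := by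
    rw [← integral_const_mul]
    calc ∫ t, 2 * s * (arcPoisson w t * √‖f t‖) ∂arcMeasure
        ≤ ∫ t, (arcPoisson w t * ‖f t‖ + arcPoisson w t * s ^ 2) ∂arcMeasure := by
          refine integral_mono_of_nonneg (Eventually.of_forall fun t ↦ ?_) (hi1.add hi2)
            (Eventually.of_forall fun t ↦ ?_)
          · have := arcPoisson_nonneg hw t
            simp only [Pi.zero_apply]
            positivity
          · have h2 := arcPoisson_nonneg hw t
            have h3 := Real.sq_sqrt (norm_nonneg (f t))
            have h4 : 2 * s * √‖f t‖ ≤ ‖f t‖ + s ^ 2 := by nlinarith [sq_nonneg (√‖f t‖ - s)]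
            nlinarith [mul_le_mul_of_nonneg_left h4 h2]
      _ = _ := by
          rw [integral_add hi1 hi2, integral_mul_const, integral_arcPoisson hw, one_mul]
  nlinarith [mul_le_mul_of_nonneg_left h hs0]

/-- The tails of the dilates of `F` are dominated by those of the boundary function. -/
theorem MemHardyOne.integral_tail_le (hF : MemHardyOne F)
    (hf : ∀ᵐ θ ∂arcMeasure, HasRadialLimit F θ (f θ)) {r : ℝ} (hr : r ∈ Ioo (0 : ℝ) 1) (M : ℝ) :
    ∫ θ, max (‖F (circleMap 0 r θ)‖ - M) 0 ∂arcMeasure ≤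
      ∫ t, max (‖f t‖ - M) 0 ∂arcMeasure := by
  have hφ := hF.integrable_norm_boundary hf
  have hh : Integrable (fun t ↦ max (‖f t‖ - M) 0) arcMeasure :=
    (hφ.sub (integrable_const M)).sup (integrable_const 0)
  rw [← integral_integral_arcPoisson_mul hr hh]
  refine integral_mono (integrable_arcMeasure_of_continuous
    (((hF.1.continuous_circleMap hr).norm.sub continuous_const).max continuous_const))
    (integrable_arcPoisson_prod hr hh).integral_prod_left fun θ ↦ ?_
  have hw := circleMap_mem_unitBall hr θ
  refine max_le ?_ (integral_nonneg fun t ↦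
    mul_nonneg (arcPoisson_nonneg hw t) (le_max_right _ _))
  have h1 := hF.norm_le_integral hf hw
  have hi1 := integrable_arcPoisson_mul hw hφ
  have hi2 := (integrable_arcPoisson hw).mul_const M
  calc ‖F (circleMap 0 r θ)‖ - M
      ≤ ∫ t, (arcPoisson (circleMap 0 r θ) t * ‖f t‖ - arcPoisson (circleMap 0 r θ) t * M)
          ∂arcMeasure := by
        rw [integral_sub hi1 hi2, integral_mul_const, integral_arcPoisson hw]
        linarith
    _ ≤ _ := by
        refine integral_mono (hi1.sub hi2) (integrable_arcPoisson_mul hw hh) fun t ↦ ?_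
        simp only [← mul_sub]
        exact mul_le_mul_of_nonneg_left (le_max_left _ _) (arcPoisson_nonneg hw t)

lemma exists_integral_tail_le {φ : ℝ → ℝ} (hφ : Integrable φ arcMeasure) {ε : ℝ} (hε : 0 < ε) :
    ∃ M : ℝ, ∫ t, max (φ t - M) 0 ∂arcMeasure ≤ ε := by
  have h : Tendsto (fun n : ℕ ↦ ∫ t, max (φ t - n) 0 ∂arcMeasure) atTop
      (𝓝 (∫ _, (0 : ℝ) ∂arcMeasure)) := by
    refine tendsto_integral_of_dominated_convergence (fun t ↦ |φ t|)
      (fun n ↦ ((hφ.sub (integrable_const _)).sup (integrable_const 0)).aestronglyMeasurable)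
      hφ.abs (fun n ↦ Eventually.of_forall fun t ↦ ?_) (Eventually.of_forall fun t ↦ ?_)
    · rw [Real.norm_of_nonneg (le_max_right _ _)]
      refine max_le ?_ (abs_nonneg _)
      linarith [le_abs_self (φ t), (Nat.cast_nonneg n : (0 : ℝ) ≤ n)]
    · obtain ⟨N, hN⟩ := exists_nat_ge (φ t)
      refine tendsto_const_nhds.congr' ?_
      filter_upwards [eventually_ge_atTop N] with n hn
      have : (N : ℝ) ≤ n := by exact_mod_cast hn
      rw [max_eq_right (by linarith)]
  rw [integral_zero] at h
  obtain ⟨n, hn⟩ := (h.eventually (ge_mem_nhds hε)).exists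
  exact ⟨n, hn⟩

/-- A function in `H¹` with real boundary values is real: its dilates are uniformly integrable, so
that the Poisson integral formula for the imaginary part passes to the limit. -/
theorem MemHardyOne.im_eq_zero (hF : MemHardyOne F)
    (hf : ∀ᵐ θ ∂arcMeasure, HasRadialLimit F θ (f θ)) (hreal : ∀ θ, (f θ).im = 0)
    {w : ℂ} (hw : w ∈ Metric.ball (0 : ℂ) 1) : (F w).im = 0 := by
  have hw' : ‖w‖ < 1 := by simpa using hw
  have hcont : ∀ n, Continuous fun θ ↦ |(F (circleMap 0 (radius n) θ)).im| := fun n ↦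
    (Complex.continuous_im.comp (hF.1.continuous_circleMap (radius_mem n))).abs
  have key : |(F w).im| ≤ ∫ t, arcPoisson w t * 0 ∂arcMeasure := by
    refine le_integral_mul_of_tendsto (A := (1 + ‖w‖) / (1 - ‖w‖))
      (u := fun n θ ↦ |(F (circleMap 0 (radius n) θ)).im|)
      (s := fun n ↦ |(F (radius n * w)).im|) (v := fun _ ↦ 0)
      (arcPoisson_nonneg hw) (arcPoisson_le hw) (div_nonneg (by positivity) (by linarith))
      (measurable_arcPoisson w) (fun _ _ ↦ abs_nonneg _)
      (fun n ↦ integrable_arcMeasure_of_continuous (hcont n)) (integrable_const 0) ?_ ?_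
      ((Complex.continuous_im.tendsto _).comp (hF.1.tendsto_dilate hw)).abs fun n ↦ ?_
    · filter_upwards [hf] with θ hθ
      have := ((Complex.continuous_im.tendsto _).comp (hθ.comp tendsto_radius_left)).abs
      rw [hreal, abs_zero] at this
      exact this
    · intro ε hε
      obtain ⟨M, hM⟩ := exists_integral_tail_le (hF.integrable_norm_boundary hf) hε
      refine ⟨M, fun n ↦ le_trans ?_ ((hF.integral_tail_le hf (radius_mem n) M).trans hM)⟩
      refine integral_mono
        (integrable_arcMeasure_of_continuous (((hcont n).sub continuous_const).max
          continuous_const))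
        (integrable_arcMeasure_of_continuous
          (((hF.1.continuous_circleMap (radius_mem n)).norm.sub continuous_const).max
            continuous_const)) fun θ ↦ ?_
      simp only
      gcongr
      exact Complex.abs_im_le_norm _
    · have han := hF.1.analyticOnNhd_dilate (radius_mem n)
      have hharm : InnerProductSpace.HarmonicOnNhd
          (fun z ↦ (F (radius n * z)).im) (Metric.closedBall 0 1) := fun z hz ↦
        (han z hz).harmonicAt_im
      have := hharm.circleAverage_poissonKernel_smul hw
      rw [circleAverage_eq_integral_arcMeasure] at this
      rw [← this]
      refine (abs_integral_le_integral_abs).trans (le_of_eq (integral_congr_ae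
        (Eventually.of_forall fun t ↦ ?_)))
      have h0 := arcPoisson_nonneg hw t
      rw [arcPoisson] at h0
      simp only [Pi.smul_apply', smul_eq_mul, abs_mul, ofReal_mul_circleMap, arcPoisson,
        abs_of_nonneg h0]
  simpa using key

end BoundaryValues

/-- A function in `H¹` whose radial limits are real almost everywhere is a real constant. -/
theorem MemHardyOne.exists_eq_const {F : ℂ → ℂ} (hF : MemHardyOne F)
    (hreal : ∀ᵐ θ ∂volume.restrict (Ioc 0 (2 * Real.pi)), ∃ a : ℝ, HasRadialLimit F θ a) :
    ∃ c : ℝ, ∀ z ∈ Metric.ball (0 : ℂ) 1, F z = c := by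
  have hch : ∀ θ, ∃ a : ℝ, (∃ b : ℝ, HasRadialLimit F θ b) → HasRadialLimit F θ a := fun θ ↦ by
    by_cases h : ∃ b : ℝ, HasRadialLimit F θ b
    · exact ⟨h.choose, fun _ ↦ h.choose_spec⟩
    · exact ⟨0, fun h' ↦ absurd h' h⟩
  choose f hf using hch
  have him : ∀ z ∈ Metric.ball (0 : ℂ) 1, (F z).im = 0 := fun z hz ↦
    hF.im_eq_zero (f := fun θ ↦ (f θ : ℂ)) ((ae_arcMeasure_iff.2 hreal).mono hf) (by simp) hz
  obtain ⟨c, hc⟩ := (hF.1.analyticOnNhd Metric.isOpen_ball).eq_const_of_im_eq_const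
    (c₀ := 0) him Metric.isOpen_ball
    ⟨Metric.nonempty_ball.2 one_pos, (convex_ball (0 : ℂ) 1).isPreconnected⟩
  refine ⟨c.re, fun z hz ↦ ?_⟩
  have := him z hz
  rw [hc z hz] at this ⊢
  exact Complex.ext rfl (by simpa using this)

/-! ### The functions `h_k` -/

/-- The average `(1 + z + ⋯ + z^(k-1)) / k`. -/
noncomputable def geomMean (k : ℕ) (z : ℂ) : ℂ := (∑ j ∈ Finset.range k, z ^ j) / (k : ℂ)

lemma nymanH_eq (k : ℕ) (z : ℂ) :
    nymanH k z = 1 / (1 - z) * Complex.log (geomMean k z) := rfl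

lemma differentiable_geomMean (k : ℕ) : Differentiable ℂ (geomMean k) := by
  unfold geomMean
  fun_prop

lemma geomMean_one {k : ℕ} (hk : k ≠ 0) : geomMean k 1 = 1 := by
  simp [geomMean, hk]

lemma geomMean_zero {k : ℕ} (hk : k ≠ 0) : geomMean k 0 = 1 / k := by
  obtain ⟨n, rfl⟩ := Nat.exists_eq_succ_of_ne_zero hk
  simp [geomMean, Finset.sum_range_succ']

lemma hasDerivAt_sum_pow_one (k : ℕ) :
    HasDerivAt (fun z : ℂ ↦ ∑ j ∈ Finset.range k, z ^ j) (∑ j ∈ Finset.range k, (j : ℂ)) 1 := by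
  refine HasDerivAt.fun_sum fun j _ ↦ ?_
  simpa using hasDerivAt_pow j (1 : ℂ)

/-- `(1 + z + ⋯ + z^(k-1)) / k` is the product of the two numbers `1 - z^k` and `1 / (1 - z)` of
positive real part, divided by `k`. -/
lemma geomMean_mem_slitPlane {k : ℕ} (hk : k ≠ 0) {z : ℂ} (hz : ‖z‖ < 1) :
    geomMean k z ∈ Complex.slitPlane := by
  have hre : ∀ x : ℂ, ‖x‖ < 1 → 0 < (1 - x).re := fun x hx ↦ by
    have := (Complex.re_le_norm x).trans_lt hx
    simpa using this
  have h1 := hre z hz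
  have h2 := hre (z ^ k) (by rw [norm_pow]; exact pow_lt_one₀ (norm_nonneg _) hz hk)
  have hk' : (0 : ℝ) < k := by exact_mod_cast Nat.pos_of_ne_zero hk
  have hmul : geomMean k z * (k * (1 - z)) = 1 - z ^ k := by
    rw [geomMean, ← mul_assoc, div_mul_cancel₀ _ (by exact_mod_cast hk), geom_sum_mul_neg]
  by_contra hs
  rw [Complex.mem_slitPlane_iff_not_le_zero, not_not, Complex.le_def] at hs
  obtain ⟨hs1, hs2⟩ := hs
  simp only [Complex.zero_re, Complex.zero_im] at hs1 hs2
  have h3 := congrArg Complex.re hmul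
  simp only [Complex.mul_re, Complex.mul_im, Complex.natCast_re, Complex.natCast_im, hs2] at h3
  have : geomMean k z = ((geomMean k z).re : ℂ) := Complex.ext rfl (by simpa using hs2)
  have h4 : (geomMean k z).re * (k * (1 - z).re) ≤ 0 :=
    mul_nonpos_of_nonpos_of_nonneg hs1 (by positivity)
  nlinarith

lemma geomMean_ne_zero {k : ℕ} (hk : k ≠ 0) {z : ℂ} (hz : ‖z‖ < 1) : geomMean k z ≠ 0 :=
  Complex.slitPlane_ne_zero (geomMean_mem_slitPlane hk hz)

/-- On the closed disk, `|1 + z + ⋯ + z^(k-1)| < k` except at `z = 1`, because `|1 + z| < 2`. -/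
lemma norm_geomMean_lt_one {k : ℕ} (hk : 2 ≤ k) {z : ℂ} (hz : ‖z‖ ≤ 1) (hz1 : z ≠ 1) :
    ‖geomMean k z‖ < 1 := by
  obtain ⟨n, rfl⟩ := Nat.exists_eq_add_of_le' hk
  have h0 : ‖1 + z‖ < 2 := by
    have hpar := parallelogram_law_with_norm ℝ (1 : ℂ) z
    have h2 : 0 < ‖1 - z‖ := norm_pos_iff.2 (sub_ne_zero.2 hz1.symm)
    rw [norm_one] at hpar
    nlinarith [norm_nonneg z, norm_nonneg (1 + z)]
  have hpos : (0 : ℝ) < (n + 2 : ℕ) := by positivity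
  rw [geomMean, norm_div, Complex.norm_natCast, div_lt_one hpos, Finset.sum_range_succ',
    Finset.sum_range_succ']
  have hsum : ‖∑ j ∈ Finset.range n, z ^ (j + 1 + 1)‖ ≤ n := by
    refine (norm_sum_le _ _).trans ?_
    refine (Finset.sum_le_card_nsmul _ _ 1 fun j _ ↦ ?_).trans (by simp)
    rw [norm_pow]
    exact pow_le_one₀ (norm_nonneg _) hz
  calc _ = ‖∑ j ∈ Finset.range n, z ^ (j + 1 + 1) + (1 + z)‖ := by congr 1; ring
    _ ≤ ‖∑ j ∈ Finset.range n, z ^ (j + 1 + 1)‖ + ‖1 + z‖ := norm_add_le _ _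
    _ < n + 2 := by linarith
    _ = _ := by push_cast; ring

lemma differentiableOn_log_geomMean {k : ℕ} (hk : k ≠ 0) :
    DifferentiableOn ℂ (fun z ↦ Complex.log (geomMean k z)) (Metric.ball 0 1) := by
  intro z hz
  exact ((differentiable_geomMean k z).clog
    (geomMean_mem_slitPlane hk (by simpa using hz))).differentiableWithinAt

lemma differentiableOn_nymanH {k : ℕ} (hk : k ≠ 0) :
    DifferentiableOn ℂ (nymanH k) (Metric.ball 0 1) := by
  refine DifferentiableOn.mul ?_ (differentiableOn_log_geomMean hk)
  refine (differentiableOn_const 1).div (by fun_prop) fun z hz h ↦ ?_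
  rw [← sub_eq_zero.1 h] at hz
  simp at hz

/-- At the point `1`, the function `log ((1 + z + ⋯ + z^(k-1)) / k)` vanishes and has the derivative
`(k - 1) / 2 ≠ 0`; hence `h_k` has a non-zero limit there. -/
lemma exists_tendsto_nymanH {k : ℕ} (hk : 2 ≤ k) :
    ∃ a ≠ 0, Tendsto (nymanH k) (𝓝[≠] 1) (𝓝 a) := by
  have hk0 : (k : ℂ) ≠ 0 := by exact_mod_cast (by omega : k ≠ 0)
  have hG1 := geomMean_one (k := k) (by omega)
  have h1 : HasDerivAt (geomMean k) ((∑ j ∈ Finset.range k, (j : ℂ)) / k) 1 :=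
    (hasDerivAt_sum_pow_one k).div_const _
  have h2 : HasDerivAt (fun z ↦ Complex.log (geomMean k z))
      ((∑ j ∈ Finset.range k, (j : ℂ)) / k) 1 := by
    simpa [hG1] using h1.clog (by simp [hG1])
  refine ⟨-((∑ j ∈ Finset.range k, (j : ℂ)) / k), ?_, ?_⟩
  · refine neg_ne_zero.2 (div_ne_zero ?_ hk0)
    have : ∑ j ∈ Finset.range k, j ≠ 0 := by
      have := Finset.single_le_sum (f := fun j : ℕ ↦ j) (fun _ _ ↦ Nat.zero_le _)
        (Finset.mem_range.2 (by omega : 1 < k))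
      omega
    rw [← Nat.cast_sum]
    exact Nat.cast_ne_zero.2 this
  · refine ((hasDerivAt_iff_tendsto_slope.1 h2).neg).congr fun z ↦ ?_
    rw [slope_def_field, nymanH_eq, hG1, Complex.log_one, sub_zero, ← div_neg, neg_sub]
    ring

lemma norm_nymanH (k : ℕ) (z : ℂ) :
    ‖nymanH k z‖ = ‖Complex.log (geomMean k z)‖ / ‖1 - z‖ := by
  rw [nymanH_eq, norm_mul, norm_div, norm_one]
  ring

/-- Near the point `1`, `|h_k|` lies between two positive constants. -/
lemma exists_bounds_nymanH_near_one {k : ℕ} (hk : 2 ≤ k) :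
    ∃ δ > 0, ∃ c > 0, ∃ C, ∀ z, z ≠ 1 → ‖z - 1‖ < δ → c ≤ ‖nymanH k z‖ ∧ ‖nymanH k z‖ ≤ C := by
  obtain ⟨a, ha, h⟩ := exists_tendsto_nymanH hk
  have ha' : 0 < ‖a‖ := norm_pos_iff.2 ha
  have h1 := h.norm.eventually (Ioo_mem_nhds (half_lt_self ha') (lt_add_one ‖a‖))
  rw [eventually_nhdsWithin_iff, Metric.eventually_nhds_iff] at h1
  obtain ⟨δ, hδ, h2⟩ := h1
  refine ⟨δ, hδ, ‖a‖ / 2, half_pos ha', ‖a‖ + 1, fun z hz hzδ ↦ ?_⟩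
  have := h2 (by rwa [dist_eq_norm]) hz
  exact ⟨this.1.le, this.2.le⟩

/-- `|h_k|` is bounded below on the disk. Away from `1`, the modulus of `(1 + ⋯ + z^(k-1)) / k` is
bounded by a constant `m < 1`, so that `|log| ≥ - log m`. -/
lemma exists_le_norm_nymanH {k : ℕ} (hk : 2 ≤ k) :
    ∃ c > 0, ∀ z ∈ Metric.ball (0 : ℂ) 1, c ≤ ‖nymanH k z‖ := by
  obtain ⟨δ, hδ, c, hc, C, h⟩ := exists_bounds_nymanH_near_one hk
  set S : Set ℂ := Metric.closedBall 0 1 \ Metric.ball 1 δ with hS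
  have hcomp : IsCompact S := (isCompact_closedBall 0 1).diff Metric.isOpen_ball
  have hm : ∃ m < 1, 0 < m ∧ ∀ z ∈ S, ‖geomMean k z‖ ≤ m := by
    have hlt : ∀ z ∈ S, ‖geomMean k z‖ < 1 := fun z hz ↦
      norm_geomMean_lt_one hk (by simpa using hz.1) (by
        rintro rfl
        exact hz.2 (Metric.mem_ball_self hδ))
    rcases S.eq_empty_or_nonempty with hSe | hne
    · exact ⟨1 / 2, by norm_num, by norm_num, by simp [hSe]⟩
    · obtain ⟨z₀, hz₀, hmax⟩ := hcomp.exists_isMaxOn hne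
        (differentiable_geomMean k).continuous.norm.continuousOn
      exact ⟨max (1 / 2) ‖geomMean k z₀‖, max_lt (by norm_num) (hlt z₀ hz₀), by positivity,
        fun z hz ↦ (hmax hz).trans (le_max_right _ _)⟩
  obtain ⟨m, hm1, hm0, hm⟩ := hm
  have hlog : 0 < -Real.log m := by simpa using Real.log_neg hm0 hm1
  refine ⟨min c (-Real.log m / 2), by positivity, fun z hz ↦ ?_⟩
  have hz' : ‖z‖ < 1 := by simpa using hz
  have hz1 : z ≠ 1 := by
    rintro rfl
    simp at hz'
  by_cases hzδ : ‖z - 1‖ < δ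
  · exact (min_le_left _ _).trans (h z hz1 hzδ).1
  · refine (min_le_right _ _).trans ?_
    have hzm := hm z ⟨Metric.ball_subset_closedBall hz, by simpa [dist_eq_norm] using hzδ⟩
    have h1 : -Real.log m ≤ ‖Complex.log (geomMean k z)‖ := by
      have h2 := Complex.abs_re_le_norm (Complex.log (geomMean k z))
      rw [Complex.log_re] at h2
      have h3 := Real.log_le_log (norm_pos_iff.2 (geomMean_ne_zero (by omega) hz')) hzm
      linarith [neg_le_abs (Real.log ‖geomMean k z‖)]
    rw [norm_nymanH]
    have h4 : ‖1 - z‖ ≤ 2 := (norm_sub_le _ _).trans (by rw [norm_one]; linarith)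
    have h5 : 0 < ‖1 - z‖ := norm_pos_iff.2 (sub_ne_zero.2 hz1.symm)
    gcongr

/-- `|log w| ≤ - log |w| + π` for `|w| ≤ 1`, and the means of `- log |w|` for
`w = (1 + z + ⋯ + z^(k-1)) / k` equal its value `log k` at `z = 0`, by harmonicity. -/
lemma circleAverage_norm_log_geomMean_le {k : ℕ} (hk : 2 ≤ k) {r : ℝ} (hr : r ∈ Ioo (0 : ℝ) 1) :
    Real.circleAverage (fun z ↦ ‖Complex.log (geomMean k z)‖) 0 r ≤ Real.log k + Real.pi := by
  have hsub : Metric.closedBall (0 : ℂ) |r| ⊆ Metric.ball 0 1 :=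
    Metric.closedBall_subset_ball (by rw [abs_of_pos hr.1]; exact hr.2)
  have hsph : Metric.sphere (0 : ℂ) |r| ⊆ Metric.ball 0 1 :=
    Metric.sphere_subset_closedBall.trans hsub
  have hne : ∀ z ∈ Metric.ball (0 : ℂ) 1, geomMean k z ≠ 0 := fun z hz ↦
    geomMean_ne_zero (by omega) (by simpa using hz)
  have hmean : Real.circleAverage (fun z ↦ Real.log ‖geomMean k z‖) 0 r = -Real.log k := by
    rw [AnalyticOnNhd.circleAverage_log_norm_of_ne_zero
      (fun z _ ↦ (differentiable_geomMean k).analyticAt z) fun z hz ↦ hne z (hsub hz),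
      geomMean_zero (by omega)]
    simp
  have hint : CircleIntegrable (fun z ↦ Real.log ‖geomMean k z‖) 0 r :=
    ContinuousOn.circleIntegrable' ((differentiable_geomMean k).continuous.norm.continuousOn.log
      fun z hz ↦ norm_ne_zero_iff.2 (hne z (hsph hz)))
  have hint2 : CircleIntegrable (fun z ↦ ‖Complex.log (geomMean k z)‖) 0 r :=
    ContinuousOn.circleIntegrable'
      ((differentiableOn_log_geomMean (by omega)).continuousOn.norm.mono hsph)
  have hint3 : CircleIntegrable (fun _ ↦ Real.pi) (0 : ℂ) r := circleIntegrable_const _ _ _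
  calc Real.circleAverage (fun z ↦ ‖Complex.log (geomMean k z)‖) 0 r
      ≤ Real.circleAverage ((fun _ ↦ Real.pi) - fun z ↦ Real.log ‖geomMean k z‖) 0 r := by
        refine Real.circleAverage_mono hint2 (hint3.sub hint) fun z hz ↦ ?_
        have hz1 : ‖z‖ < 1 := by simpa using hsph hz
        have h1 := norm_geomMean_lt_one hk hz1.le (by rintro rfl; simp at hz1)
        have h2 := Complex.norm_le_abs_re_add_abs_im (Complex.log (geomMean k z))
        rw [Complex.log_re, Complex.log_im,
          abs_of_nonpos (Real.log_nonpos (norm_nonneg _) h1.le)] at h2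
        have h3 := Complex.abs_arg_le_pi (geomMean k z)
        simp only [Pi.sub_apply]
        linarith
    _ = Real.log k + Real.pi := by
        rw [Real.circleAverage_sub hint3 hint, hmean, Real.circleAverage_const]
        ring

/-- `h_k` is bounded near `1`, and elsewhere `|h_k|` is dominated by the logarithm. -/
theorem memHardyOne_nymanH {k : ℕ} (hk : 2 ≤ k) : MemHardyOne (nymanH k) := by
  have hk0 : k ≠ 0 := by omega
  refine ⟨differentiableOn_nymanH hk0, ?_⟩
  obtain ⟨δ, hδ, c, hc, C, h⟩ := exists_bounds_nymanH_near_one hk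
  refine ⟨|C| + δ⁻¹ * (Real.log k + Real.pi), fun r hr ↦ ?_⟩
  have hsph : Metric.sphere (0 : ℂ) |r| ⊆ Metric.ball 0 1 :=
    Metric.sphere_subset_closedBall.trans
      (Metric.closedBall_subset_ball (by rw [abs_of_pos hr.1]; exact hr.2))
  have hint1 : CircleIntegrable (fun z ↦ ‖nymanH k z‖) 0 r :=
    ContinuousOn.circleIntegrable' ((differentiableOn_nymanH hk0).continuousOn.norm.mono hsph)
  have hint2 : CircleIntegrable (δ⁻¹ • fun z ↦ ‖Complex.log (geomMean k z)‖) 0 r :=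
    ContinuousOn.circleIntegrable'
      (((differentiableOn_log_geomMean hk0).continuousOn.norm.mono hsph).const_smul δ⁻¹)
  have hint3 : CircleIntegrable (fun _ ↦ |C|) (0 : ℂ) r := circleIntegrable_const _ _ _
  have key : Real.circleAverage (fun z ↦ ‖nymanH k z‖) 0 r ≤
      |C| + δ⁻¹ * (Real.log k + Real.pi) := by
    calc Real.circleAverage (fun z ↦ ‖nymanH k z‖) 0 r
        ≤ Real.circleAverage
            ((fun _ ↦ |C|) + δ⁻¹ • fun z ↦ ‖Complex.log (geomMean k z)‖) 0 r := by
          refine Real.circleAverage_mono hint1 (hint3.add hint2) fun z hz ↦ ?_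
          have hz1 : ‖z‖ < 1 := by simpa using hsph hz
          have hne : z ≠ 1 := by rintro rfl; simp at hz1
          simp only [Pi.add_apply, Pi.smul_apply, smul_eq_mul]
          by_cases hzδ : ‖z - 1‖ < δ
          · have h1 := (h z hne hzδ).2.trans (le_abs_self C)
            have h2 : 0 ≤ δ⁻¹ * ‖Complex.log (geomMean k z)‖ := by positivity
            linarith
          · rw [not_lt, norm_sub_rev] at hzδ
            rw [norm_nymanH, div_eq_inv_mul]
            have h1 : ‖1 - z‖⁻¹ * ‖Complex.log (geomMean k z)‖ ≤
                δ⁻¹ * ‖Complex.log (geomMean k z)‖ := by gcongr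
            linarith [abs_nonneg C]
      _ ≤ _ := by
          rw [Real.circleAverage_add hint3 hint2, Real.circleAverage_const,
            Real.circleAverage_smul, smul_eq_mul]
          gcongr
          exact circleAverage_norm_log_geomMean_le hk hr
  simpa only [Real.circleAverage_def, smul_eq_mul] using key

/-! ### Rigidity -/

/-- The quotient of a member of `H¹` by a holomorphic function bounded away from zero is a member of
`H¹`. -/
lemma MemHardyOne.div {g f : ℂ → ℂ} (hg : MemHardyOne g)
    (hf : DifferentiableOn ℂ f (Metric.ball 0 1)) {c : ℝ} (hc : 0 < c)
    (hcf : ∀ z ∈ Metric.ball (0 : ℂ) 1, c ≤ ‖f z‖) : MemHardyOne (fun z ↦ g z / f z) := by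
  have hd : DifferentiableOn ℂ (fun z ↦ g z / f z) (Metric.ball 0 1) :=
    hg.1.div hf fun z hz ↦ norm_pos_iff.1 (hc.trans_le (hcf z hz))
  obtain ⟨C, hC⟩ := hg.2
  refine ⟨hd, c⁻¹ * C, fun r hr ↦ ?_⟩
  calc (2 * Real.pi)⁻¹ * ∫ θ in (0 : ℝ)..2 * Real.pi, ‖g (circleMap 0 r θ) / f (circleMap 0 r θ)‖
      ≤ (2 * Real.pi)⁻¹ * ∫ θ in (0 : ℝ)..2 * Real.pi, c⁻¹ * ‖g (circleMap 0 r θ)‖ := by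
        gcongr
        refine intervalIntegral.integral_mono Real.two_pi_pos.le
          ((hd.continuous_circleMap hr).norm.intervalIntegrable _ _)
          (((hg.1.continuous_circleMap hr).norm.const_mul _).intervalIntegrable _ _) fun θ ↦ ?_
        rw [norm_div, div_eq_inv_mul]
        gcongr
        exact hcf _ (circleMap_mem_unitBall hr θ)
    _ = c⁻¹ * ((2 * Real.pi)⁻¹ * ∫ θ in (0 : ℝ)..2 * Real.pi, ‖g (circleMap 0 r θ)‖) := by
        rw [intervalIntegral.integral_const_mul]
        ring
    _ ≤ c⁻¹ * C := by
        gcongr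
        exact hC r hr

/-- A member of `H¹` bounded away from zero is rigid: if `g` has the same boundary argument, then
`g / f` is a member of `H¹` with positive boundary values, hence constant. -/
theorem MemHardyOne.isRigid_of_le_norm {f : ℂ → ℂ} (hf : MemHardyOne f) {c : ℝ} (hc : 0 < c)
    (hcf : ∀ z ∈ Metric.ball (0 : ℂ) 1, c ≤ ‖f z‖) : IsRigid f := by
  have hne : ∀ z ∈ Metric.ball (0 : ℂ) 1, f z ≠ 0 := fun z hz ↦
    norm_pos_iff.1 (hc.trans_le (hcf z hz))
  have h0 : (0 : ℂ) ∈ Metric.ball (0 : ℂ) 1 := by simp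
  refine ⟨hf, ⟨0, h0, hne 0 h0⟩, fun g hg hfg ↦ ?_⟩
  have hpos : ∀ᵐ θ ∂volume.restrict (Ioc 0 (2 * Real.pi)),
      ∃ a : ℝ, 0 < a ∧ HasRadialLimit (fun z ↦ g z / f z) θ a := by
    filter_upwards [hfg] with θ hθ
    obtain ⟨a, b, ha, hb, ha0, hb0, harg⟩ := hθ
    have hab := (Complex.arg_eq_arg_iff ha0 hb0).1 harg.symm
    refine ⟨‖b‖ / ‖a‖, div_pos (norm_pos_iff.2 hb0) (norm_pos_iff.2 ha0), ?_⟩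
    have hlim := Tendsto.div hb ha ha0
    rw [← hab, mul_div_cancel_right₀ _ ha0] at hlim
    rw [HasRadialLimit, Complex.ofReal_div]
    exact hlim
  obtain ⟨t, ht⟩ := (hg.div hf.1 hc hcf).exists_eq_const
    (hpos.mono fun θ ⟨a, _, ha⟩ ↦ ⟨a, ha⟩)
  refine ⟨t, ?_, fun z hz ↦ by rw [← ht z hz, div_mul_cancel₀ _ (hne z hz)]⟩
  have hvol : volume.restrict (Ioc 0 (2 * Real.pi)) ≠ 0 := by
    simp [Measure.restrict_eq_zero, Real.pi_pos]
  have : (ae (volume.restrict (Ioc 0 (2 * Real.pi)))).NeBot := ae_neBot.2 hvol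
  obtain ⟨θ, a, ha0, ha⟩ := hpos.exists
  have hconst : Tendsto (fun r : ℝ ↦ g (circleMap 0 r θ) / f (circleMap 0 r θ)) (𝓝[<] 1)
      (𝓝 (t : ℂ)) := by
    refine tendsto_const_nhds.congr' ?_
    filter_upwards [Ioo_mem_nhdsLT (zero_lt_one' ℝ)] with r hr
    exact (ht _ (circleMap_mem_unitBall hr θ)).symm
  have : (a : ℂ) = t := tendsto_nhds_unique ha hconst
  rwa [← Complex.ofReal_inj.1 this]

theorem mainTheorem3 (k : ℕ) (hk : 2 ≤ k) : IsRigid (nymanH k) := by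
  obtain ⟨c, hc, h⟩ := exists_le_norm_nymanH hk
  exact (memHardyOne_nymanH hk).isRigid_of_le_norm hc h
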